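/- Let $G$ be a finite undirected connected chordal graph on the node set $V$, viewed as the essential graph of a Markov equivalence class of DAGs, and write $\mathbf D(G)$ for that class, i.e. the set of all DAGs $D$ on $V$ such that the union of the edge sets of all DAGs Markov equivalent to $D$ is the edge set of $G$ (here an undirected edge $a-b$ is the pair of edges $(a,b),(b,a)$; a joint distribution of variables $(X_i)_{i\in V}$ is Markov with respect to a DAG if every variable is independent of its non-descendants given its parents, and two DAGs are Markov equivalent if the same joint distributions are Markov with respect to them). Let $v\in V$ and let $P\subseteq V$ be the parent set of $v$ in some $D\in\mathbf D(G)$. Let $R=\mathcal P_v^P(G)$ be the $\{\{v\}\}$-essential graph of such a $D$, i.e. the graph on $V$ whose edge set is the union of the edge sets of all DAGs that are statistically indistinguishable from $D$ given observational data and data from interventions on the single target $\{v\}$. (Here a DAG $D$ generates the pairs $(f^{\emptyset},f^{\{v\}})$ of strictly positive joint distributions such that $f^{\emptyset}$ is Markov with respect to $D$, $f^{\{v\}}$ is Markov with respect to $D$ with all edges into $v$ removed, and for every $a\neq v$ the conditional distribution of $X_a$ given its parents in $D$ is the same under $f^{\emptyset}$ and $f^{\{v\}}$; two DAGs are statistically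 indistinguishable if they generate the same pairs. Variables have finite state spaces.) An edge between $a$ and $b$ in $R$ is directed as $a\to b$ if $(a,b)\in R$ and $(b,a)\notin R$, and undirected if $(a,b),(b,a)\in R$. Put $$C_R=\{b\in V: v\to b \text{ in } R\},\qquad A_R=\{a\in V\setminus (P\cup\{v\}): a \text{ is not adjacent to } v \text{ in } G \text{ and } G[V\setminus P] \text{ contains no path from } a \text{ to } v\},$$ $$D_R=V\setminus(A_R\cup C_R\cup P\cup\{v\}).$$ Then: (1) no edge of $G$ joins a node of $A_R$ to a node of $C_R\cup D_R\cup\{v\}$; (2) every edge of $R$ between a node $a\in P$ and a node $b\in C_R$ is directed as $a\to b$; (3) every edge of $R$ between a node $a\in C_R\cup P$ and a node $b\in D_R$ is directed as $a\to b$; (4) every edge of the induced subgraph $R[A_R\cup P]$ is undirected. -/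

import Mathlib

/-! ### Partially directed graphs

A (partially directed) graph on `V` is a `Digraph V`; the edge between `a` and `b` is undirected
if both `Adj a b` and `Adj b a` hold. -/

namespace Digraph

variable {V : Type*}

/-- The edge between `a` and `b` is present and directed as `a → b`. -/
def IsDirectedEdge (H : Digraph V) (a b : V) : Prop := H.Adj a b ∧ ¬ H.Adj b a

/-- There is an edge (directed or undirected) between `a` and `b`. -/
def HasEdge (H : Digraph V) (a b : V) : Prop := H.Adj a b ∨ H.Adj b a

/-- The set of parents of `v`. -/
def parents (H : Digraph V) (v : V) : Set V := {a | H.IsDirectedEdge a v}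

/-- The set of children of `v`. -/
def children (H : Digraph V) (v : V) : Set V := {b | H.IsDirectedEdge v b}

/-- `D` is a directed acyclic graph: no node can be reached from itself along a nonempty path. -/
def IsDAG (D : Digraph V) : Prop := ∀ a, ¬ Relation.TransGen D.Adj a a

/-- The nodes other than `a` that are not descendants of `a`, in a directed acyclic graph. -/
def nondescendants (D : Digraph V) (a : V) : Set V :=
  {b | b ≠ a ∧ ¬ Relation.TransGen D.Adj a b}

/-- The intervention graph `D^(I)`: all edges directed towards nodes in `I` are removed. -/
def intervene (D : Digraph V) (I : Set V) : Digraph V where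
  Adj a b := D.Adj a b ∧ b ∉ I

end Digraph

/-! ### Undirected graphs -/

namespace SimpleGraph

variable {V : Type*}

/-- An undirected graph seen as a partially directed graph all of whose edges are undirected. -/
def asDigraph (G : SimpleGraph V) : Digraph V where
  Adj := G.Adj

/-- Every cycle of length at least four has a chord. -/
def IsChordal (G : SimpleGraph V) : Prop :=
  ∀ (u : V) (c : G.Walk u u), c.IsCycle → 4 ≤ c.length → ∃ e, c.IsChord e

/-- Undirected connected chordal graph. -/
def IsUCCG (G : SimpleGraph V) : Prop := G.Connected ∧ G.IsChordal

/-- `T` is an `(a, b)`-separator: `a, b ∉ T` and no path joins `a` to `b` in `G[V \ T]`. -/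
def IsSeparator (G : SimpleGraph V) (T : Set V) (a b : V) : Prop :=
  ∃ (ha : a ∈ Tᶜ) (hb : b ∈ Tᶜ), ¬ (G.induce Tᶜ).Reachable ⟨a, ha⟩ ⟨b, hb⟩

end SimpleGraph

/-! ### Markov property and (interventional) Markov equivalence

A joint law of finitely many discrete random variables `(X_i)_{i ∈ V}`, with `X_i` taking values in
a finite set `α i`, is given by its mass function `f : (∀ i, α i) → ℝ`. -/

namespace CausalModel

variable {V : Type*} [Fintype V] {α : V → Type} [∀ i, Fintype (α i)]

open Classical in
/-- `f` is the mass function of a joint law. -/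
def IsJointLaw (f : (∀ i, α i) → ℝ) : Prop := f ∈ stdSimplex ℝ (∀ i, α i)

open Classical in
/-- The probability of the event `X_S = x_S`, where `S` is a set of variables. -/
noncomputable def marginal (f : (∀ i, α i) → ℝ) (S : Set V) (x : ∀ i, α i) : ℝ :=
  ∑ y : (∀ i, α i), if ∀ i ∈ S, y i = x i then f y else 0

/-- The conditional probability of `X_a = x_a` given `X_S = x_S`. -/
noncomputable def conditional (f : (∀ i, α i) → ℝ) (a : V) (S : Set V) (x : ∀ i, α i) : ℝ :=
  marginal f (insert a S) x / marginal f S x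

/-- `X_A` and `X_B` are independent given `X_S`. -/
def CondIndep (f : (∀ i, α i) → ℝ) (A B S : Set V) : Prop :=
  ∀ x, marginal f (A ∪ B ∪ S) x * marginal f S x = marginal f (A ∪ S) x * marginal f (B ∪ S) x

/-- Markov property of `f` with respect to the directed acyclic graph `D`: every variable is
independent of its non-descendants given its parents. -/
def IsMarkov (D : Digraph V) (f : (∀ i, α i) → ℝ) : Prop :=
  ∀ a, CondIndep f {a} (D.nondescendants a) (D.parents a)

/-- `(f I)` for `I ∈ 𝓘 ∪ {∅}` is a family of interventional laws that the causal graph `D` can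
generate: the law `f I` under intervention on `I` (`f ∅` is the observational law) is strictly
positive and Markov with respect to the intervention graph `D^(I)`, and the law of each variable
given its parents is the same under all interventions that do not target it. -/
def IsInterventionalFamily (D : Digraph V) (𝓘 : Set (Set V))
    (f : Set V → (∀ i, α i) → ℝ) : Prop :=
  (∀ I ∈ insert ∅ 𝓘, IsJointLaw (f I) ∧ (∀ x, 0 < f I x) ∧ IsMarkov (D.intervene I) (f I)) ∧
  ∀ I ∈ insert ∅ 𝓘, ∀ J ∈ insert ∅ 𝓘, ∀ a, a ∉ I ∪ J →
    ∀ x, conditional (f I) a (D.parents a) x = conditional (f J) a (D.parents a) x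

/-- `D₁` and `D₂` have the same Markov property. -/
def MarkovEquiv (D₁ D₂ : Digraph V) : Prop :=
  ∀ (α : V → Type) [∀ i, Fintype (α i)] (f : (∀ i, α i) → ℝ), IsJointLaw f →
    (IsMarkov D₁ f ↔ IsMarkov D₂ f)

/-- `D₁` and `D₂` are `𝓘`-Markov equivalent: statistically indistinguishable from observational
data and interventions on the targets in `𝓘`. -/
def IMarkovEquiv (𝓘 : Set (Set V)) (D₁ D₂ : Digraph V) : Prop :=
  ∀ (α : V → Type) [∀ i, Fintype (α i)] (f : Set V → (∀ i, α i) → ℝ),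
    IsInterventionalFamily D₁ 𝓘 f ↔ IsInterventionalFamily D₂ 𝓘 f

/-- The essential graph of `D`: the union of all directed acyclic graphs Markov equivalent
to `D`. -/
def essentialGraph (D : Digraph V) : Digraph V :=
  sSup {D' | D'.IsDAG ∧ MarkovEquiv D D'}

/-- The `𝓘`-essential graph of `D`: the union of all directed acyclic graphs `𝓘`-Markov equivalent
to `D`. -/
def iEssentialGraph (𝓘 : Set (Set V)) (D : Digraph V) : Digraph V :=
  sSup {D' | D'.IsDAG ∧ IMarkovEquiv 𝓘 D D'}

/-- The Markov equivalence class with essential graph `G`. -/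
def mec (G : SimpleGraph V) : Set (Digraph V) :=
  {D | D.IsDAG ∧ essentialGraph D = G.asDigraph}

/-- `R` is the graph `𝓟_v^P(G)`: the `{{v}}`-essential graph of a member `D` of the Markov
equivalence class of `G` in which `v` has parent set `P`. -/
def IsInterventionResult (G : SimpleGraph V) (v : V) (P : Set V) (R : Digraph V) : Prop :=
  ∃ D ∈ mec G, D.parents v = P ∧ R = iEssentialGraph {{v}} D

end CausalModel

/-! ### The partition of the nodes -/

section Partition

variable {V : Type*}

/-- `C_R`: the children of `v` in `R`. -/
def nodesC (R : Digraph V) (v : V) : Set V := R.children v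

/-- `A_R`: the nodes separated from `v` by `P`. -/
def nodesA (G : SimpleGraph V) (v : V) (P : Set V) : Set V :=
  {a | a ∉ G.neighborSet v ∧ G.IsSeparator P a v}

/-- `D_R`: all other nodes (apart from `v` itself). -/
def nodesD (G : SimpleGraph V) (R : Digraph V) (v : V) (P : Set V) : Set V :=
  (nodesA G v P ∪ nodesC R v ∪ P ∪ {v})ᶜ

end Partition

/-! The proof replaces statistical equivalence by a combinatorial notion. Members of the class of
`G` are moral orientations: acyclic, with skeleton `G`, without v-structures. By
`iEssentialGraph_adj_iff`, the edges of `R` are exactly those of the moral orientations in which `v`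
has parent set `P`.

One direction of that lemma tests equivalence on binary laws. Fair coins with a biased parity on a
nonempty set `T` are Markov for a DAG exactly when some node of `T` has the rest of `T` as parents.
Sets `T` of two and three nodes then show that equivalence preserves the skeleton and the absence of
v-structures. Intervening at `v` detects the reversal of an edge into `v` (`IMarkovEquiv.not_adj`).
For the other direction, a node and its parents form a clique in a moral orientation, and a positive
law factorizing over cliques is Markov for every moral orientation
(`isMarkov_of_clique_factorization`). Equal parents of `v` then give equal laws after intervention.

In a moral orientation, every node connected to `v` outside the parents of `v` is a descendant of
`v`. Hence an edge oriented against (2) or (3) would create a directed cycle or a v-structure, while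
(1) is connectivity outside `P`. For (4), no edge enters the union of `A_R` and `P`, so the
orientation inside it can be replaced by that of any other member of the class (`reorient`) without
changing the parents of `v`. -/

namespace Digraph

variable {V : Type*}

/-! ### Directed acyclic graphs and ancestral sets -/

theorem IsDAG.irrefl {D : Digraph V} (hD : D.IsDAG) (a : V) : ¬ D.Adj a a :=
  fun h => hD a (.single h)

theorem IsDAG.asymm {D : Digraph V} (hD : D.IsDAG) {a b : V} (h : D.Adj a b) : ¬ D.Adj b a :=
  fun h' => hD a ((Relation.TransGen.single h).tail h')

theorem IsDAG.mem_parents {D : Digraph V} (hD : D.IsDAG) {a b : V} :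
    a ∈ D.parents b ↔ D.Adj a b :=
  ⟨fun h => h.1, fun h => ⟨h, hD.asymm h⟩⟩

theorem IsDAG.parents_subset_nondescendants {D : Digraph V} (hD : D.IsDAG) (a : V) :
    D.parents a ⊆ D.nondescendants a := by
  intro b hb
  refine ⟨?_, fun h => hD a (h.tail hb.1)⟩
  rintro rfl
  exact hD.irrefl _ hb.1

theorem notMem_nondescendants (D : Digraph V) (a : V) : a ∉ D.nondescendants a :=
  fun h => h.1 rfl

theorem IsDAG.notMem_parents {D : Digraph V} (hD : D.IsDAG) (a : V) : a ∉ D.parents a :=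
  fun h => D.notMem_nondescendants a (hD.parents_subset_nondescendants a h)

theorem parents_subset_of_mem_nondescendants (D : Digraph V) {a b : V}
    (hb : b ∈ D.nondescendants a) : D.parents b ⊆ D.nondescendants a := by
  intro c hc
  refine ⟨?_, fun h => hb.2 (h.tail hc.1)⟩
  rintro rfl
  exact hb.2 (.single hc.1)

theorem IsDAG.wellFounded [Finite V] {D : Digraph V} (hD : D.IsDAG) :
    WellFounded (Relation.TransGen D.Adj) := by
  have : Std.Irrefl (Relation.TransGen D.Adj) := ⟨hD⟩
  exact Finite.wellFounded_of_trans_of_irrefl _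

/-- Induction along the sets of nodes closed under taking parents, from the set of all nodes
downwards. -/
theorem IsDAG.ancestral_induction [Fintype V] [DecidableEq V] {D : Digraph V} (hD : D.IsDAG)
    {p : Finset V → Prop} (univ : p Finset.univ)
    (step : ∀ (S : Finset V) (i : V), i ∉ S → (∀ j ∈ S, D.parents j ⊆ S) → D.parents i ⊆ S →
      p (insert i S) → p S) :
    ∀ S : Finset V, (∀ j ∈ S, D.parents j ⊆ S) → p S := by
  intro S
  induction hn : (Sᶜ).card using Nat.strong_induction_on generalizing S with
  | _ n ih =>
    intro hS
    by_cases hu : S = Finset.univ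
    · rwa [hu]
    -- A node outside `S` that is minimal in the ancestor order has all its parents in `S`.
    obtain ⟨i, hi, hmin⟩ := hD.wellFounded.has_min {i | i ∉ S} (by
      by_contra hne
      refine hu (Finset.eq_univ_iff_forall.2 fun i => ?_)
      by_contra hi
      exact hne ⟨i, hi⟩)
    have hpar : D.parents i ⊆ S := fun j hj => by
      by_contra hjS
      exact hmin j hjS (.single hj.1)
    refine step S i hi hS hpar (ih _ ?_ _ rfl ?_)
    · rw [← hn]
      refine Finset.card_lt_card ?_
      rw [Finset.ssubset_iff_subset_ne]
      refine ⟨Finset.compl_subset_compl.2 (Finset.subset_insert _ _), fun h => ?_⟩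
      have := Finset.mem_compl.2 hi
      rw [← h] at this
      simp at this
    · intro j hj
      rw [Finset.coe_insert]
      rcases Finset.mem_insert.1 hj with rfl | hj
      · exact hpar.trans (Set.subset_insert _ _)
      · exact (hS j hj).trans (Set.subset_insert _ _)

theorem IsDAG.intervene {D : Digraph V} (hD : D.IsDAG) (I : Set V) : (D.intervene I).IsDAG :=
  fun a h => hD a (Relation.TransGen.mono (fun _ _ h => h.1) a a h)

theorem intervene_empty (D : Digraph V) : D.intervene ∅ = D := by
  ext a b
  simp [Digraph.intervene]

theorem IsDAG.parents_intervene_of_notMem {D : Digraph V} (hD : D.IsDAG) {I : Set V} {a : V}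
    (ha : a ∉ I) : (D.intervene I).parents a = D.parents a := by
  ext b
  rw [(hD.intervene I).mem_parents, hD.mem_parents]
  simp [Digraph.intervene, ha]

theorem parents_intervene_of_mem (D : Digraph V) {I : Set V} {a : V}
    (ha : a ∈ I) : (D.intervene I).parents a = ∅ := by
  ext b
  simp [Digraph.intervene, Digraph.parents, Digraph.IsDirectedEdge, ha]

end Digraph

namespace CausalModel

variable {V : Type*} [Fintype V] {α : V → Type} [∀ i, Fintype (α i)]

/-! ### Marginals and conditionals -/

theorem dependsOn_marginal (f : (∀ i, α i) → ℝ) (S : Set V) : DependsOn (marginal f S) S := by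
  intro x x' h
  unfold marginal
  refine Finset.sum_congr rfl fun y _ => ?_
  have : (∀ i ∈ S, y i = x i) ↔ (∀ i ∈ S, y i = x' i) :=
    forall₂_congr fun i hi => by rw [h i hi]
  classical exact if_congr this rfl rfl

theorem marginal_univ (f : (∀ i, α i) → ℝ) (x : ∀ i, α i) : marginal f Set.univ x = f x := by
  unfold marginal
  rw [Finset.sum_eq_single x]
  · simp
  · intro y _ hy
    rw [if_neg]
    exact fun h => hy (funext fun i => h i trivial)
  · simp

open Classical in
theorem marginal_empty (f : (∀ i, α i) → ℝ) (x : ∀ i, α i) : marginal f ∅ x = ∑ y, f y := by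
  simp [marginal]

theorem marginal_pos {f : (∀ i, α i) → ℝ} (hf : ∀ x, 0 < f x) (S : Set V) (x : ∀ i, α i) :
    0 < marginal f S x := by
  classical
  unfold marginal
  refine Finset.sum_pos' (fun y _ => ?_) ⟨x, Finset.mem_univ _, ?_⟩
  · split_ifs
    exacts [(hf y).le, le_rfl]
  · simpa using hf x

open Classical in
theorem sum_marginal_insert (f : (∀ i, α i) → ℝ) {S : Set V} {i : V} (hi : i ∉ S)
    (x : ∀ i, α i) :
    ∑ t, marginal f (insert i S) (Function.update x i t) = marginal f S x := by
  unfold marginal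
  rw [Finset.sum_comm]
  refine Finset.sum_congr rfl fun y _ => ?_
  have key : ∀ t, (∀ j ∈ insert i S, y j = Function.update x i t j) ↔
      (y i = t ∧ ∀ j ∈ S, y j = x j) := by
    intro t
    rw [Set.forall_mem_insert, Function.update_self]
    refine and_congr_right fun _ => forall₂_congr fun j hj => ?_
    rw [Function.update_of_ne (by rintro rfl; exact hi hj)]
  by_cases h : ∀ j ∈ S, y j = x j
  · rw [if_pos h, Finset.sum_eq_single (y i)]
    · exact if_pos ((key _).2 ⟨rfl, h⟩)
    · exact fun t _ ht => if_neg fun h' => ht ((key t).1 h').1.symm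
    · simp
  · rw [if_neg h]
    exact Finset.sum_eq_zero fun t _ => if_neg fun h' => h ((key t).1 h').2

/-- If the conditional law of `X_a` given `X_T` only depends on `X_S`, where `S ⊆ T`, then it is the
conditional law of `X_a` given `X_S`. -/
theorem marginal_insert_of_subset {f k : (∀ i, α i) → ℝ} {S T : Set V} {a : V} (hST : S ⊆ T)
    (ha : a ∉ T) (hk : DependsOn k (insert a S))
    (h : ∀ x, marginal f (insert a T) x = k x * marginal f T x) (x : ∀ i, α i) :
    marginal f (insert a S) x = k x * marginal f S x := by
  classical
  suffices H : ∀ F : Finset V, a ∉ S ∪ F →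
      (∀ x, marginal f (insert a (S ∪ F)) x = k x * marginal f (S ∪ F) x) →
      ∀ x, marginal f (insert a S) x = k x * marginal f S x by
    refine H (T.toFinset) ?_ ?_ x
    · rwa [Set.coe_toFinset, Set.union_eq_right.2 hST]
    · rwa [Set.coe_toFinset, Set.union_eq_right.2 hST]
  intro F
  induction F using Finset.induction_on with
  | empty => intro _ h; simpa using h
  | insert i F _ ih =>
    intro haF h
    rw [Finset.coe_insert, Set.union_insert] at haF h
    by_cases hi : i ∈ S ∪ F
    · rw [Set.insert_eq_of_mem hi] at haF h
      exact ih haF h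
    · have hai : i ≠ a := by
        rintro rfl
        exact haF (Set.mem_insert _ _)
      have haF' : a ∉ S ∪ F := fun h' => haF (Set.mem_insert_of_mem _ h')
      -- Sum the identity over the values of `X_i`; the factor `k` is constant in this sum because
      -- `i` lies outside `insert a S`.
      refine ih haF' fun x => ?_
      rw [← sum_marginal_insert f hi, ← sum_marginal_insert f (i := i) (S := insert a (S ∪ F)),
        Finset.mul_sum]
      · refine Finset.sum_congr rfl fun t _ => ?_
        rw [Set.insert_comm, h]
        congr 1
        refine hk fun j hj => Function.update_of_ne ?_ _ _
        rintro rfl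
        rcases hj with rfl | hj
        exacts [hai rfl, hi (Or.inl hj)]
      · rintro (rfl | h')
        exacts [hai rfl, hi h']

theorem dependsOn_conditional (f : (∀ i, α i) → ℝ) (a : V) (S : Set V) :
    DependsOn (conditional f a S) (insert a S) := by
  intro x x' h
  unfold conditional
  rw [dependsOn_marginal f _ h, dependsOn_marginal f S fun i hi => h i (Set.mem_insert_of_mem _ hi)]

theorem conditional_pos {f : (∀ i, α i) → ℝ} (hf : ∀ x, 0 < f x) (a : V) (S : Set V)
    (x : ∀ i, α i) : 0 < conditional f a S x :=
  div_pos (marginal_pos hf _ _) (marginal_pos hf _ _)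

theorem conditional_eq_of_marginal_eq {f : (∀ i, α i) → ℝ} (hf : ∀ x, 0 < f x) {a : V} {S : Set V}
    {x : ∀ i, α i} {c : ℝ} (h : marginal f (insert a S) x = c * marginal f S x) :
    conditional f a S x = c := by
  rw [conditional, h, mul_div_cancel_right₀ _ (marginal_pos hf _ _).ne']

open Classical in
theorem sum_conditional {f : (∀ i, α i) → ℝ} (hf : ∀ x, 0 < f x) {a : V} {S : Set V}
    (ha : a ∉ S) (x : ∀ i, α i) : ∑ t, conditional f a S (Function.update x a t) = 1 := by
  unfold conditional
  have : ∀ t, marginal f S (Function.update x a t) = marginal f S x := fun t =>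
    dependsOn_marginal f S fun i hi => Function.update_of_ne (by rintro rfl; exact ha hi) _ _
  simp only [this]
  rw [← Finset.sum_div, sum_marginal_insert f ha, div_self (marginal_pos hf _ _).ne']

/-! ### Markov property and factorization -/

theorem condIndep_nondescendants_iff {D : Digraph V} (hD : D.IsDAG) (f : (∀ i, α i) → ℝ) (a : V) :
    CondIndep f {a} (D.nondescendants a) (D.parents a) ↔
      ∀ x, marginal f (insert a (D.nondescendants a)) x * marginal f (D.parents a) x =
        marginal f (insert a (D.parents a)) x * marginal f (D.nondescendants a) x := by
  unfold CondIndep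
  rw [Set.union_assoc, Set.union_eq_left.2 (hD.parents_subset_nondescendants a)]
  simp only [Set.singleton_union]

/-- The conditional law given the non-descendants is a function of `a` and its parents only, so by
`marginal_insert_of_subset` it is also the conditional law given the parents. -/
theorem isMarkov_of_marginal_eq {D : Digraph V} (hD : D.IsDAG) {f : (∀ i, α i) → ℝ}
    (k : V → (∀ i, α i) → ℝ) (hk : ∀ a, DependsOn (k a) (insert a (D.parents a)))
    (h : ∀ a x, marginal f (insert a (D.nondescendants a)) x =
      k a x * marginal f (D.nondescendants a) x) : IsMarkov D f := by
  intro a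
  rw [condIndep_nondescendants_iff hD]
  intro x
  rw [marginal_insert_of_subset (hD.parents_subset_nondescendants a)
    (D.notMem_nondescendants a) (hk a) (h a), h]
  ring

theorem IsMarkov.marginal_eq {D : Digraph V} (hD : D.IsDAG) {f : (∀ i, α i) → ℝ}
    (hpos : ∀ x, 0 < f x) (hf : IsMarkov D f) (a : V) (x : ∀ i, α i) :
    marginal f (insert a (D.nondescendants a)) x =
      conditional f a (D.parents a) x * marginal f (D.nondescendants a) x := by
  have h := (condIndep_nondescendants_iff hD f a).1 (hf a) x
  rw [conditional, div_mul_eq_mul_div, eq_div_iff (marginal_pos hpos _ _).ne', h]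

open Classical in
/-- Positive conditional laws `k i` of every variable `X_i` given its parents. -/
structure IsKernelFamily (D : Digraph V) (k : V → (∀ i, α i) → ℝ) : Prop where
  pos : ∀ i x, 0 < k i x
  dependsOn : ∀ i, DependsOn (k i) (insert i (D.parents i))
  sum_eq_one : ∀ i x, ∑ t, k i (Function.update x i t) = 1

open Classical in
-- Kernels outside an ancestral set sum to one and can be removed one node at a time, since the
-- kernels remaining do not involve the node summed out.
theorem IsKernelFamily.marginal_prod {D : Digraph V} (hD : D.IsDAG)
    {k : V → (∀ i, α i) → ℝ} (hk : IsKernelFamily D k) (S : Finset V)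
    (hS : ∀ j ∈ S, D.parents j ⊆ S) :
    ∀ x, marginal (fun x => ∏ i, k i x) S x = ∏ i ∈ S, k i x := by
  refine hD.ancestral_induction (p := fun S => ∀ x, marginal (fun x => ∏ i, k i x) S x =
    ∏ i ∈ S, k i x) ?_ ?_ S hS
  · intro x
    rw [Finset.coe_univ, marginal_univ]
  · intro S i hi hS hpar ih x
    rw [← sum_marginal_insert _ (i := i) (by simpa using hi)]
    have h : ∀ t, marginal (fun x => ∏ i, k i x) (insert i (S : Set V)) (Function.update x i t) =
        k i (Function.update x i t) * ∏ j ∈ S, k j x := by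
      intro t
      rw [← Finset.coe_insert, ih, Finset.prod_insert hi]
      congr 1
      refine Finset.prod_congr rfl fun j hj => hk.dependsOn j fun l hl =>
        Function.update_of_ne ?_ _ _
      rintro rfl
      rcases hl with rfl | hl
      exacts [hi hj, hi (hS j hj hl)]
    simp only [h]
    rw [← Finset.sum_mul, hk.sum_eq_one, one_mul]

theorem IsKernelFamily.prod_pos {D : Digraph V} {k : V → (∀ i, α i) → ℝ}
    (hk : IsKernelFamily D k) (x : ∀ i, α i) : 0 < ∏ i, k i x :=
  Finset.prod_pos fun i _ => hk.pos i x

theorem IsKernelFamily.isJointLaw [∀ i, Nonempty (α i)] {D : Digraph V} (hD : D.IsDAG)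
    {k : V → (∀ i, α i) → ℝ} (hk : IsKernelFamily D k) : IsJointLaw fun x => ∏ i, k i x := by
  classical
  refine ⟨fun x => (hk.prod_pos x).le, ?_⟩
  have x : ∀ i, α i := fun i => Classical.arbitrary _
  have := hk.marginal_prod hD ∅ (by simp) x
  rw [Finset.coe_empty, marginal_empty] at this
  rw [Finset.prod_empty] at this
  convert this

theorem IsKernelFamily.marginal_insert {D : Digraph V} (hD : D.IsDAG) {k : V → (∀ i, α i) → ℝ}
    (hk : IsKernelFamily D k) {a : V} {S : Set V} (ha : a ∉ S) (hS : ∀ j ∈ S, D.parents j ⊆ S)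
    (hpar : D.parents a ⊆ S) (x : ∀ i, α i) :
    marginal (fun x => ∏ i, k i x) (insert a S) x =
      k a x * marginal (fun x => ∏ i, k i x) S x := by
  classical
  lift S to Finset V using S.toFinite
  rw [hk.marginal_prod hD S hS, ← Finset.coe_insert, hk.marginal_prod hD,
    Finset.prod_insert (by simpa using ha)]
  intro j hj
  rw [Finset.coe_insert]
  rcases Finset.mem_insert.1 hj with rfl | hj
  · exact hpar.trans (Set.subset_insert _ _)
  · exact (hS j hj).trans (Set.subset_insert _ _)

theorem IsKernelFamily.marginal_insert_nondescendants {D : Digraph V} (hD : D.IsDAG)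
    {k : V → (∀ i, α i) → ℝ} (hk : IsKernelFamily D k) (a : V) (x : ∀ i, α i) :
    marginal (fun x => ∏ i, k i x) (insert a (D.nondescendants a)) x =
      k a x * marginal (fun x => ∏ i, k i x) (D.nondescendants a) x :=
  hk.marginal_insert hD (D.notMem_nondescendants a)
    (fun _ hj => D.parents_subset_of_mem_nondescendants hj) (hD.parents_subset_nondescendants a) x

theorem IsKernelFamily.isMarkov {D : Digraph V} (hD : D.IsDAG) {k : V → (∀ i, α i) → ℝ}
    (hk : IsKernelFamily D k) : IsMarkov D fun x => ∏ i, k i x :=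
  isMarkov_of_marginal_eq hD k hk.dependsOn (hk.marginal_insert_nondescendants hD)

theorem IsKernelFamily.conditional_prod {D : Digraph V} (hD : D.IsDAG) {k : V → (∀ i, α i) → ℝ}
    (hk : IsKernelFamily D k) (a : V) (x : ∀ i, α i) :
    conditional (fun x => ∏ i, k i x) a (D.parents a) x = k a x :=
  conditional_eq_of_marginal_eq hk.prod_pos <|
    marginal_insert_of_subset (hD.parents_subset_nondescendants a) (D.notMem_nondescendants a)
      (hk.dependsOn a) (hk.marginal_insert_nondescendants hD a) x

theorem isKernelFamily_conditional {D : Digraph V} (hD : D.IsDAG) {f : (∀ i, α i) → ℝ}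
    (hf : ∀ x, 0 < f x) : IsKernelFamily D fun i => conditional f i (D.parents i) where
  pos i := conditional_pos hf i _
  dependsOn i := dependsOn_conditional f i _
  sum_eq_one i := sum_conditional hf (hD.notMem_parents i)

/-- The chain rule for a law that is Markov with respect to a directed acyclic graph. -/
theorem IsMarkov.eq_prod {D : Digraph V} (hD : D.IsDAG) {f : (∀ i, α i) → ℝ}
    (hlaw : IsJointLaw f) (hpos : ∀ x, 0 < f x) (hf : IsMarkov D f) (x : ∀ i, α i) :
    f x = ∏ i, conditional f i (D.parents i) x := by
  classical
  have key := hD.ancestral_induction (p := fun S => f x = marginal f S x *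
    ∏ i ∈ Sᶜ, conditional f i (D.parents i) x) ?_ ?_ ∅ (by simp)
  · rw [Finset.coe_empty, marginal_empty, Finset.compl_empty] at key
    have h1 : ∑ y, f y = 1 := by convert hlaw.2
    rwa [h1, one_mul] at key
  · simp [marginal_univ]
  · intro S i hi hS hpar ih
    rw [ih, Finset.coe_insert]
    -- An ancestral set that misses `i` contains no descendant of `i`.
    have hnd : (S : Set V) ⊆ D.nondescendants i := by
      intro j hj
      refine ⟨by rintro rfl; exact hi hj, fun h => ?_⟩
      have : ∀ j, Relation.TransGen D.Adj i j → j ∉ S := by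
        intro j h
        induction h with
        | single h => exact fun hj => hi (hS _ hj (hD.mem_parents.2 h))
        | tail _ h ih => exact fun hj => ih (hS _ hj (hD.mem_parents.2 h))
      exact this j h hj
    have hm : marginal f (insert i (S : Set V)) x =
        conditional f i (D.parents i) x * marginal f S x := by
      refine marginal_insert_of_subset hnd (D.notMem_nondescendants i) ?_
        (hf.marginal_eq hD hpos i) x
      intro x y hxy
      exact dependsOn_conditional f i _ fun j hj => hxy j (Set.insert_subset_insert hpar hj)
    have hc : Sᶜ = insert i (insert i S)ᶜ := by
      ext j
      simp only [Finset.mem_compl, Finset.mem_insert]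
      by_cases h : j = i
      · simp [h, hi]
      · simp [h]
    rw [hm, hc, Finset.prod_insert (by simp)]
    ring

end CausalModel

namespace CausalModel

variable {V : Type*}

/-! ### Parity laws -/

/-- The sign of a binary value. -/
def boolSign (t : Bool) : ℝ := if t then -1 else 1

theorem abs_boolSign (t : Bool) : |boolSign t| = 1 := by
  cases t <;> simp [boolSign]

theorem boolSign_not (t : Bool) : boolSign (!t) = -boolSign t := by
  cases t <;> simp [boolSign]

/-- The parity of the binary variables in `T`, as a sign. -/
def paritySign (T : Finset V) (x : V → Bool) : ℝ := ∏ i ∈ T, boolSign (x i)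

theorem abs_paritySign (T : Finset V) (x : V → Bool) : |paritySign T x| = 1 := by
  rw [paritySign, Finset.abs_prod]
  exact Finset.prod_eq_one fun i _ => abs_boolSign _

theorem paritySign_congr {T : Finset V} {x y : V → Bool} (h : ∀ i ∈ T, x i = y i) :
    paritySign T x = paritySign T y :=
  Finset.prod_congr rfl fun i hi => by rw [h i hi]

open Classical in
theorem paritySign_update_not {T : Finset V} {i : V} (hi : i ∈ T) (x : V → Bool) :
    paritySign T (Function.update x i (!x i)) = -paritySign T x := by
  unfold paritySign
  rw [← Finset.mul_prod_erase _ _ hi, ← Finset.mul_prod_erase T (fun i => boolSign (x i)) hi,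
    Function.update_self, boolSign_not, neg_mul]
  congr 2
  exact Finset.prod_congr rfl fun j hj => by
    rw [Function.update_of_ne (Finset.ne_of_mem_erase hj)]

open Classical in
theorem sum_paritySign_update {T : Finset V} {i : V} (hi : i ∈ T) (x : V → Bool) :
    ∑ t, paritySign T (Function.update x i t) = 0 := by
  have h := paritySign_update_not hi (Function.update x i true)
  simp only [Function.update_self, Function.update_idem, Bool.not_true] at h
  rw [Fintype.sum_bool, h, add_neg_cancel]

open Classical in
/-- Fair coins, except that the parity of the coins in `T` is biased through the coin `t`. -/
noncomputable def parityKernel (T : Finset V) (t i : V) (x : V → Bool) : ℝ :=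
  1 / 2 * if i = t then 1 + 1 / 2 * paritySign T x else 1

theorem parityKernel_self (T : Finset V) (t : V) (x : V → Bool) :
    parityKernel T t t x = 1 / 2 * (1 + 1 / 2 * paritySign T x) := by
  simp [parityKernel]

theorem parityKernel_of_ne (T : Finset V) {t i : V} (h : i ≠ t) (x : V → Bool) :
    parityKernel T t i x = 1 / 2 := by
  simp [parityKernel, h]

/-- The bias `1 / 2` keeps the kernel positive because a sign is at least `-1`; the values at `t`
sum to one because flipping `t` flips the parity. -/
theorem isKernelFamily_parityKernel {D : Digraph V} {T : Finset V} {t : V} (ht : t ∈ T)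
    (hT : ∀ s ∈ T, s ≠ t → s ∈ D.parents t) :
    IsKernelFamily (α := fun _ => Bool) D (parityKernel T t) where
  pos i x := by
    by_cases h : i = t
    · subst h
      rw [parityKernel_self]
      have := (abs_le.1 (abs_paritySign T x).le).1
      linarith
    · rw [parityKernel_of_ne T h]
      norm_num
  dependsOn i := by
    intro x y hxy
    by_cases h : i = t
    · subst h
      rw [parityKernel_self, parityKernel_self, paritySign_congr (x := x) (y := y)]
      intro s hs
      refine hxy s ?_
      by_cases hsi : s = i
      · exact Or.inl hsi
      · exact Or.inr (hT s hs hsi)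
    · rw [parityKernel_of_ne T h, parityKernel_of_ne T h]
  sum_eq_one i x := by
    by_cases h : i = t
    · subst h
      simp only [parityKernel_self]
      rw [← Finset.mul_sum, Finset.sum_add_distrib, ← Finset.mul_sum]
      have := sum_paritySign_update ht x
      rw [this]
      simp
    · simp only [parityKernel_of_ne T h]
      simp

theorem isKernelFamily_uniform (D : Digraph V) :
    IsKernelFamily (α := fun _ => Bool) D (fun _ _ => 1 / 2) where
  pos i x := by norm_num
  dependsOn i := fun _ _ _ => rfl
  sum_eq_one i x := by simp

/-- A node of `T` has all the other nodes of `T` among its parents. -/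
def _root_.Digraph.HasSink (D : Digraph V) (T : Finset V) : Prop :=
  ∃ t ∈ T, ∀ s ∈ T, s ≠ t → s ∈ D.parents t

/-- The graph with an edge to `t` from every other node of `T`. -/
def starDigraph (T : Finset V) (t : V) : Digraph V where
  Adj s u := u = t ∧ s ∈ T ∧ s ≠ t

theorem isDAG_starDigraph (T : Finset V) (t : V) : (starDigraph T t).IsDAG := by
  intro a h
  have h1 : a = t := by
    cases h with
    | single h => exact h.1
    | tail _ h => exact h.1
  obtain ⟨b, hab, -⟩ := Relation.TransGen.head'_iff.1 h
  exact hab.2.2 h1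

/-- An auxiliary DAG that generates the parity law. Positivity, total mass and conditionals can be
read off from it whether or not `T` has a sink in the graph under study. -/
theorem isKernelFamily_starDigraph {T : Finset V} {t : V} (ht : t ∈ T) :
    IsKernelFamily (α := fun _ => Bool) (starDigraph T t) (parityKernel T t) :=
  isKernelFamily_parityKernel ht fun _ hs hst =>
    (isDAG_starDigraph T t).mem_parents.2 ⟨rfl, hs, hst⟩

variable [Fintype V]

/-- The law of fair coins with biased parity of the coins in `T`. -/
noncomputable def parityLaw (T : Finset V) (x : V → Bool) : ℝ :=
  (1 / 2) ^ Fintype.card V * (1 + 1 / 2 * paritySign T x)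

/-- The right side does not mention `t`: the same law arises whichever node of `T` carries the bias.
-/
theorem prod_parityKernel (T : Finset V) (t : V) :
    (fun x => ∏ i, parityKernel T t i x) = parityLaw T := by
  classical
  funext x
  simp only [parityKernel, parityLaw, Finset.prod_mul_distrib, Finset.prod_const,
    Finset.card_univ, Finset.prod_ite_eq', Finset.mem_univ, if_true]

theorem isMarkov_parityLaw {D : Digraph V} (hD : D.IsDAG) {T : Finset V} (hT : D.HasSink T) :
    IsMarkov (α := fun _ => Bool) D (parityLaw T) := by
  obtain ⟨t, ht, hT⟩ := hT
  rw [← prod_parityKernel T t]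
  exact (isKernelFamily_parityKernel ht hT).isMarkov hD

theorem parityLaw_pos {T : Finset V} (hT : T.Nonempty) (x : V → Bool) : 0 < parityLaw T x := by
  obtain ⟨t, ht⟩ := hT
  rw [← prod_parityKernel T t]
  exact (isKernelFamily_starDigraph ht).prod_pos x

theorem isJointLaw_parityLaw {T : Finset V} (hT : T.Nonempty) :
    IsJointLaw (α := fun _ => Bool) (parityLaw T) := by
  obtain ⟨t, ht⟩ := hT
  rw [← prod_parityKernel T t]
  exact (isKernelFamily_starDigraph ht).isJointLaw (isDAG_starDigraph T t)

/-- If `S` contains all the other nodes of `T`, the conditional law of the node `t` of `T` given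
`X_S` is the parity kernel. -/
theorem conditional_parityLaw {T : Finset V} {t : V} (ht : t ∈ T) {S : Set V} (htS : t ∉ S)
    (hS : ∀ s ∈ T, s ≠ t → s ∈ S) (x : V → Bool) :
    conditional (α := fun _ => Bool) (parityLaw T) t S x = parityKernel T t t x := by
  refine conditional_eq_of_marginal_eq (parityLaw_pos ⟨t, ht⟩) ?_
  rw [← prod_parityKernel T t]
  refine (isKernelFamily_starDigraph ht).marginal_insert (isDAG_starDigraph T t) htS ?_ ?_ x
  · intro j hj s hs
    obtain rfl : j = t := hs.1.1
    exact absurd hj htS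
  · intro s hs
    exact hS s hs.1.2.1 hs.1.2.2

/-- Let `t` be a node of `T` without descendants in `T`. Given its non-descendants, its law is the
parity kernel, which is sensitive to every other node of `T`. The Markov property lets only parents
matter, so all of these are parents. -/
theorem hasSink_of_isMarkov_parityLaw {D : Digraph V} (hD : D.IsDAG) {T : Finset V}
    (hT : T.Nonempty) (h : IsMarkov (α := fun _ => Bool) D (parityLaw T)) : D.HasSink T := by
  classical
  have : Std.Irrefl (Function.swap (Relation.TransGen D.Adj)) := ⟨hD⟩
  obtain ⟨t, ht, hlast⟩ := (Finite.wellFounded_of_trans_of_irrefl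
    (Function.swap (Relation.TransGen D.Adj))).has_min (T : Set V) hT
  refine ⟨t, ht, fun s hs hst => ?_⟩
  by_contra hpar
  have hpos := parityLaw_pos hT
  have key : ∀ x, conditional (α := fun _ => Bool) (parityLaw T) t (D.parents t) x =
      parityKernel T t t x := by
    intro x
    rw [← conditional_parityLaw ht (D.notMem_nondescendants t) (fun u hu hut => ⟨hut, hlast u hu⟩)]
    exact (conditional_eq_of_marginal_eq hpos (h.marginal_eq hD hpos t x)).symm
  -- Flipping a non-parent `s` leaves the conditional law unchanged but negates the parity, which
  -- would force a sign to be zero.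
  have h1 := key (fun _ => true)
  have h2 := key (Function.update (fun _ => true) s (!true))
  rw [dependsOn_conditional (α := fun _ => Bool) (parityLaw T) t (D.parents t)
    (y := fun _ => true), h1, parityKernel_self, parityKernel_self,
    paritySign_update_not hs (fun _ => true)] at h2
  · have h3 := abs_paritySign T fun _ => true
    have h4 : paritySign T (fun _ => true) = 0 := by linarith
    rw [h4] at h3
    simp at h3
  · intro i hi
    refine Function.update_of_ne ?_ _ _
    rintro rfl
    rcases hi with hi | hi
    exacts [hst hi, hpar hi]

end CausalModel

/-! ### Moral orientations -/

/-- `D` is an acyclic orientation of `G` without v-structures. -/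
structure SimpleGraph.IsMoralOrientation {V : Type*} (G : SimpleGraph V) (D : Digraph V) : Prop where
  isDAG : D.IsDAG
  adj_iff : ∀ a b, D.Adj a b ∨ D.Adj b a ↔ G.Adj a b
  moral : ∀ a b c, D.Adj a c → D.Adj b c → a ≠ b → G.Adj a b

namespace SimpleGraph.IsMoralOrientation

variable {V : Type*} {G : SimpleGraph V} {D : Digraph V}

theorem adj (h : G.IsMoralOrientation D) {a b : V} (hab : D.Adj a b) : G.Adj a b :=
  (h.adj_iff a b).1 (Or.inl hab)

/-- In an orientation without v-structures, the nodes adjacent to a descendant of `a` are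
descendants of `a`, `a` itself, or parents of `a`. -/
theorem reflTransGen_or_adj (h : G.IsMoralOrientation D) {a d : V}
    (had : Relation.ReflTransGen D.Adj a d) {e : V} (hde : G.Adj d e) :
    Relation.ReflTransGen D.Adj a e ∨ D.Adj e a := by
  induction had generalizing e with
  | refl => exact ((h.adj_iff _ _).2 hde).imp_left .single
  | @tail b c hab hbc ih =>
    rcases (h.adj_iff _ _).2 hde with hce | hec
    · exact Or.inl ((hab.tail hbc).tail hce)
    -- Here `b` and `e` are both parents of `c`, hence equal or adjacent, and adjacency allows the
    -- induction hypothesis at `b`.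
    · by_cases hbe : b = e
      · exact Or.inl (hbe ▸ hab)
      · exact ih (h.moral _ _ _ hbc hec hbe)

theorem isClique_parents (h : G.IsMoralOrientation D) (i : V) :
    G.IsClique (insert i (D.parents i)) := by
  rw [SimpleGraph.isClique_insert]
  exact ⟨fun a ha b hb hab => h.moral a b i ha.1 hb.1 hab, fun b hb _ => (h.adj hb.1).symm⟩

/-- If `a` or a descendant of `a` were in the clique, then `d`, being adjacent to it, would be `a`,
a descendant or a parent of `a` by `reflTransGen_or_adj`. This is what separates the clique factors
in `isMarkov_of_clique_factorization`. -/
theorem clique_subset_nondescendants (h : G.IsMoralOrientation D) {C : Set V} (hC : G.IsClique C)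
    {a d : V} (hdC : d ∈ C) (hd : d ∈ D.nondescendants a) (hda : d ∉ D.parents a) :
    C ⊆ D.nondescendants a := by
  intro e he
  have key : ¬ Relation.ReflTransGen D.Adj a e := by
    intro hae
    have hed : e ≠ d := by
      rintro rfl
      rcases Relation.reflTransGen_iff_eq_or_transGen.1 hae with h' | h'
      exacts [hd.1 h', hd.2 h']
    rcases h.reflTransGen_or_adj hae (hC he hdC hed) with h' | h'
    · rcases Relation.reflTransGen_iff_eq_or_transGen.1 h' with h' | h'
      exacts [hd.1 h', hd.2 h']
    · exact hda (h.isDAG.mem_parents.2 h')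
  exact ⟨fun h' => key (h' ▸ .refl), fun h' => key h'.to_reflTransGen⟩

theorem _root_.Digraph.IsDAG.hasSink_pair_iff (h : D.IsDAG) [DecidableEq V] {a b : V} (hab : a ≠ b) :
    D.HasSink {a, b} ↔ D.Adj a b ∨ D.Adj b a := by
  unfold Digraph.HasSink
  simp only [h.mem_parents, Finset.mem_insert, Finset.mem_singleton]
  constructor
  · rintro ⟨t, rfl | rfl, ht⟩
    · exact Or.inr (ht b (Or.inr rfl) hab.symm)
    · exact Or.inl (ht a (Or.inl rfl) hab)
  · rintro (h' | h')
    · refine ⟨b, Or.inr rfl, ?_⟩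
      rintro s (rfl | rfl) hs
      exacts [h', absurd rfl hs]
    · refine ⟨a, Or.inl rfl, ?_⟩
      rintro s (rfl | rfl) hs
      exacts [absurd rfl hs, h']

theorem _root_.Digraph.IsDAG.hasSink_triple (h : D.IsDAG) [DecidableEq V] {a b c : V}
    (hac : D.Adj a c) (hbc : D.Adj b c) : D.HasSink {a, b, c} := by
  unfold Digraph.HasSink
  simp only [h.mem_parents, Finset.mem_insert, Finset.mem_singleton]
  refine ⟨c, Or.inr (Or.inr rfl), ?_⟩
  rintro s (rfl | rfl | rfl) hs
  exacts [hac, hbc, absurd rfl hs]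

theorem _root_.Digraph.HasSink.triple [DecidableEq V] {a b c : V}
    (h : D.HasSink {a, b, c}) (hab : a ≠ b) (hac : a ≠ c) (hbc : b ≠ c) :
    D.Adj a b ∨ D.Adj b a ∨ (D.Adj a c ∧ D.Adj b c) := by
  obtain ⟨t, ht, h⟩ := h
  simp only [Finset.mem_insert, Finset.mem_singleton] at ht h
  rcases ht with rfl | rfl | rfl
  · exact Or.inr (Or.inl (h b (by simp) hab.symm).1)
  · exact Or.inl (h a (by simp) hab).1
  · exact Or.inr (Or.inr ⟨(h a (by simp) hac).1, (h b (by simp) hbc).1⟩)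

/-- Two-element sets recover the skeleton; three-element sets transfer the absence of v-structures.
-/
theorem of_hasSink_iff (h : G.IsMoralOrientation D) {D' : Digraph V} (hD' : D'.IsDAG)
    (hs : ∀ T : Finset V, T.Nonempty → (D.HasSink T ↔ D'.HasSink T)) :
    G.IsMoralOrientation D' := by
  classical
  have hadj : ∀ a b, D'.Adj a b ∨ D'.Adj b a ↔ G.Adj a b := by
    intro a b
    by_cases hab : a = b
    · subst hab
      simp [hD'.irrefl]
    · rw [← Digraph.IsDAG.hasSink_pair_iff hD' hab, ← hs _ (by simp), Digraph.IsDAG.hasSink_pair_iff h.isDAG hab, h.adj_iff]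
  refine ⟨hD', hadj, fun a b c hac hbc hab => ?_⟩
  have hac' : a ≠ c := by rintro rfl; exact hD'.irrefl _ hac
  have hbc' : b ≠ c := by rintro rfl; exact hD'.irrefl _ hbc
  rcases ((hs _ (by simp)).2 (hD'.hasSink_triple hac hbc)).triple hab hac' hbc' with h' | h' | h'
  exacts [h.adj h', (h.adj h').symm, h.moral a b c h'.1 h'.2 hab]

end SimpleGraph.IsMoralOrientation

namespace CausalModel

variable {V : Type*} [Fintype V]

/-! ### Consequences of Markov equivalence -/

theorem hasSink_of_forall_isMarkov {D D' : Digraph V} (hD : D.IsDAG) (hD' : D'.IsDAG)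
    (h : ∀ f : (V → Bool) → ℝ, IsJointLaw (α := fun _ => Bool) f → (∀ x, 0 < f x) →
      IsMarkov (α := fun _ => Bool) D f → IsMarkov (α := fun _ => Bool) D' f)
    {T : Finset V} (hT : T.Nonempty) (hs : D.HasSink T) : D'.HasSink T :=
  hasSink_of_isMarkov_parityLaw hD' hT
    (h _ (isJointLaw_parityLaw hT) (parityLaw_pos hT) (isMarkov_parityLaw hD hs))

theorem MarkovEquiv.hasSink_iff {D D' : Digraph V} (hD : D.IsDAG) (hD' : D'.IsDAG)
    (h : MarkovEquiv D D') {T : Finset V} (hT : T.Nonempty) : D.HasSink T ↔ D'.HasSink T :=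
  ⟨hasSink_of_forall_isMarkov hD hD' (fun f hf _ => (h (fun _ => Bool) f hf).1) hT,
    hasSink_of_forall_isMarkov hD' hD (fun f hf _ => (h (fun _ => Bool) f hf).2) hT⟩

theorem exists_markovEquiv_of_mem_mec {G : SimpleGraph V} {D : Digraph V} (hD : D ∈ mec G)
    {a b : V} (hab : G.Adj a b) : ∃ D' : Digraph V, D'.IsDAG ∧ MarkovEquiv D D' ∧ D'.Adj a b := by
  have : (essentialGraph D).Adj a b := by
    rw [hD.2]
    exact hab
  obtain ⟨D', ⟨h1, h2⟩, h3⟩ := Digraph.sSup_adj.1 this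
  exact ⟨D', h1, h2, h3⟩

theorem isMoralOrientation_of_mem_mec {G : SimpleGraph V} {D : Digraph V} (hD : D ∈ mec G) :
    G.IsMoralOrientation D := by
  classical
  have hle : ∀ a b, D.Adj a b → G.Adj a b := by
    intro a b hab
    have : (essentialGraph D).Adj a b :=
      Digraph.sSup_adj.2 ⟨D, ⟨hD.1, fun α _ f _ => Iff.rfl⟩, hab⟩
    rwa [hD.2] at this
  have hadj : ∀ a b, D.Adj a b ∨ D.Adj b a ↔ G.Adj a b := by
    intro a b
    refine ⟨fun h => h.elim (hle a b) fun h => (hle b a h).symm, fun h => ?_⟩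
    obtain ⟨D', hD', he, hab⟩ := exists_markovEquiv_of_mem_mec hD h
    rw [← Digraph.IsDAG.hasSink_pair_iff hD.1 h.ne, he.hasSink_iff hD.1 hD' (by simp),
      Digraph.IsDAG.hasSink_pair_iff hD' h.ne]
    exact Or.inl hab
  refine ⟨hD.1, hadj, fun a b c hac hbc hab => ?_⟩
  -- All edges of `G` are reversible within the class, so some equivalent DAG has `c → a`. There `c`
  -- cannot be the sink of the triple, and so `a` and `b` are adjacent.
  obtain ⟨D', hD', he, hca⟩ := exists_markovEquiv_of_mem_mec hD (hle _ _ hac).symm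
  rcases ((he.hasSink_iff hD.1 hD' (by simp)).1 (hD.1.hasSink_triple hac hbc)).triple hab
    (hle _ _ hac).ne (hle _ _ hbc).ne with h' | h' | h'
  · rw [← hadj, ← Digraph.IsDAG.hasSink_pair_iff hD.1 hab,
      he.hasSink_iff hD.1 hD' (by simp),
      Digraph.IsDAG.hasSink_pair_iff hD' hab]
    exact Or.inl h'
  · rw [← hadj, ← Digraph.IsDAG.hasSink_pair_iff hD.1 hab,
      he.hasSink_iff hD.1 hD' (by simp),
      Digraph.IsDAG.hasSink_pair_iff hD' hab]
    exact Or.inr h'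
  · exact absurd hca (hD'.asymm h'.1)

/-! ### Interventional families given by kernels -/

section

variable {V : Type*} {α : V → Type} [∀ i, Fintype (α i)]

/-- A single positive law for `X_v`, as a kernel without parents. -/
structure IsRootKernel (v : V) (u : (∀ i, α i) → ℝ) : Prop where
  pos : ∀ x, 0 < u x
  dependsOn : DependsOn u {v}
  sum_eq_one : ∀ x, open Classical in ∑ t, u (Function.update x v t) = 1

open Classical in
theorem IsKernelFamily.update_intervene {D : Digraph V} (hD : D.IsDAG)
    {k : V → (∀ i, α i) → ℝ} (hk : IsKernelFamily D k) {v : V} {u : (∀ i, α i) → ℝ}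
    (hu : IsRootKernel v u) : IsKernelFamily (D.intervene {v}) (Function.update k v u) where
  pos i x := by
    by_cases h : i = v
    · subst h
      simpa using hu.pos x
    · simpa [h] using hk.pos i x
  dependsOn i := by
    by_cases h : i = v
    · subst h
      rw [Function.update_self, D.parents_intervene_of_mem (Set.mem_singleton _)]
      simpa using hu.dependsOn
    · rw [Function.update_of_ne h, hD.parents_intervene_of_notMem (by simpa using h)]
      exact hk.dependsOn i
  sum_eq_one i x := by
    by_cases h : i = v
    · subst h
      simpa using hu.sum_eq_one x
    · simpa [h] using hk.sum_eq_one i x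

variable [Fintype V]

theorem isRootKernel_conditional {f : (∀ i, α i) → ℝ} (hf : ∀ x, 0 < f x) (v : V) :
    IsRootKernel v (conditional f v ∅) where
  pos := conditional_pos hf v ∅
  dependsOn := by simpa using dependsOn_conditional f v ∅
  sum_eq_one := sum_conditional hf (by simp)

open Classical in
theorem IsKernelFamily.isInterventionalFamily [∀ i, Nonempty (α i)] {D : Digraph V} (hD : D.IsDAG)
    {k : V → (∀ i, α i) → ℝ} (hk : IsKernelFamily D k) {v : V} {u : (∀ i, α i) → ℝ}
    (hu : IsRootKernel v u) {f : Set V → (∀ i, α i) → ℝ} (hf : f ∅ = fun x => ∏ i, k i x)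
    (hfv : f {v} = fun x => ∏ i, Function.update k v u i x) :
    IsInterventionalFamily D {{v}} f := by
  have hk' := hk.update_intervene hD hu
  have hD' := hD.intervene {v}
  have hc : ∀ I ∈ insert (∅ : Set V) ({{v}} : Set (Set V)), ∀ a, a ∉ I → ∀ x,
      conditional (f I) a (D.parents a) x = k a x := by
    rintro I (rfl | rfl) a ha x
    · rw [hf, hk.conditional_prod hD]
    · rw [hfv, ← hD.parents_intervene_of_notMem ha, hk'.conditional_prod hD',
        Function.update_of_ne ha]
  refine ⟨?_, fun I hI J hJ a ha x => ?_⟩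
  · rintro I (rfl | rfl)
    · rw [hf, D.intervene_empty]
      exact ⟨hk.isJointLaw hD, hk.prod_pos, hk.isMarkov hD⟩
    · rw [hfv]
      exact ⟨hk'.isJointLaw hD', hk'.prod_pos, hk'.isMarkov hD'⟩
  · rw [hc I hI a (fun h => ha (Or.inl h)), hc J hJ a (fun h => ha (Or.inr h))]

theorem IsJointLaw.nonempty {f : (∀ i, α i) → ℝ} (hf : IsJointLaw f) (i : V) :
    Nonempty (α i) := by
  classical
  by_contra h
  rw [not_nonempty_iff] at h
  have : IsEmpty (∀ i, α i) := ⟨fun x => h.elim (x i)⟩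
  have h1 : ∑ x, f x = 1 := by convert hf.2
  rw [Fintype.sum_empty] at h1
  exact zero_ne_one h1

/-- Every positive observational law extends to an interventional family: keep its conditionals and
replace the kernel of `v` by the marginal law of `X_v`. -/
theorem IMarkovEquiv.isMarkov {D D' : Digraph V} (hD : D.IsDAG) {v : V}
    (h : IMarkovEquiv {{v}} D D') {f : (∀ i, α i) → ℝ} (hlaw : IsJointLaw f)
    (hpos : ∀ x, 0 < f x) (hf : IsMarkov D f) : IsMarkov D' f := by
  classical
  have := hlaw.nonempty
  set k : V → (∀ i, α i) → ℝ := fun i => conditional f i (D.parents i)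
  have hfam : IsInterventionalFamily D {{v}} (fun I => if v ∈ I then
      (fun x => ∏ i, Function.update k v (conditional f v ∅) i x) else f) := by
    refine (isKernelFamily_conditional hD hpos).isInterventionalFamily hD
      (isRootKernel_conditional hpos v) ?_ ?_
    · simpa using funext (hf.eq_prod hD hlaw hpos)
    · simp [k]
  have := (((h α _).1 hfam).1 ∅ (Or.inl rfl)).2.2
  simpa [Digraph.intervene_empty] using this

end

theorem IMarkovEquiv.symm {D D' : Digraph V} {𝓘 : Set (Set V)} (h : IMarkovEquiv 𝓘 D D') :
    IMarkovEquiv 𝓘 D' D :=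
  fun α _ f => (h α f).symm

theorem IMarkovEquiv.hasSink_iff {D D' : Digraph V} (hD : D.IsDAG) (hD' : D'.IsDAG) {v : V}
    (h : IMarkovEquiv {{v}} D D') {T : Finset V} (hT : T.Nonempty) :
    D.HasSink T ↔ D'.HasSink T :=
  ⟨hasSink_of_forall_isMarkov hD hD' (fun _ => h.isMarkov hD) hT,
    hasSink_of_forall_isMarkov hD' hD (fun _ => h.symm.isMarkov hD') hT⟩

/-- Correlate `X_a` and `X_v` through `a → v` and intervene with a fair coin at `v`, which removes
the correlation. If `v` were a parent of `a` in `D'`, the law of `X_a` given its parents would have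
to be invariant, yet it is biased before and uniform after. -/
theorem IMarkovEquiv.not_adj {D D' : Digraph V} (hD : D.IsDAG) (hD' : D'.IsDAG) {v a : V}
    (h : IMarkovEquiv {{v}} D D') (hav : D.Adj a v) : ¬ D'.Adj v a := by
  classical
  intro hva
  have hne : a ≠ v := by
    rintro rfl
    exact hD.irrefl _ hav
  have hk : IsKernelFamily (α := fun _ => Bool) D (parityKernel {a, v} v) := by
    refine isKernelFamily_parityKernel (by simp) fun s hs hsv => ?_
    obtain rfl : s = a := by simpa [hsv] using hs
    exact hD.mem_parents.2 hav
  have hu : IsRootKernel (α := fun _ => Bool) v (fun _ => 1 / 2) :=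
    ⟨fun _ => by norm_num, fun _ _ _ => rfl, fun _ => by simp⟩
  have hupd : Function.update (parityKernel {a, v} v) v (fun _ => 1 / 2) =
      fun _ _ => 1 / 2 := by
    funext i x
    by_cases hi : i = v
    · subst hi
      simp
    · rw [Function.update_of_ne hi, parityKernel_of_ne _ hi]
  have hfam : IsInterventionalFamily (α := fun _ => Bool) D {{v}} (fun I => if v ∈ I then
      (fun _ => ∏ _i : V, (1 / 2 : ℝ)) else parityLaw {a, v}) := by
    refine hk.isInterventionalFamily hD hu ?_ ?_
    · rw [if_neg (Set.notMem_empty v), prod_parityKernel]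
    · rw [if_pos (Set.mem_singleton v), hupd]
  have key := ((h (fun _ => Bool) _).1 hfam).2 ∅ (Or.inl rfl) {v} (Or.inr rfl) a
    (by simpa using hne) (fun _ => true)
  beta_reduce at key
  rw [if_neg (Set.notMem_empty v), if_pos (Set.mem_singleton v),
    (isKernelFamily_uniform D').conditional_prod hD',
    conditional_parityLaw (by simp) (hD'.notMem_parents a), parityKernel_self] at key
  · have h3 := abs_paritySign {a, v} fun _ => true
    have h4 : paritySign {a, v} (fun _ => true) = 0 := by linarith
    rw [h4] at h3
    simp at h3
  · intro s hs hsa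
    obtain rfl : s = v := by simpa [hsa] using hs
    exact hD'.mem_parents.2 hva

end CausalModel

namespace CausalModel

/-! ### Factorization over cliques -/

theorem dependsOn_prod {V ι : Type*} {α : V → Type} {s : Finset ι} {k : ι → (∀ i, α i) → ℝ} {S : Set V}
    (h : ∀ i ∈ s, DependsOn (k i) S) : DependsOn (fun x => ∏ i ∈ s, k i x) S :=
  fun _ _ hxy => Finset.prod_congr rfl fun i hi => h i hi hxy

variable {V : Type*} [Fintype V] {α : V → Type} [∀ i, Fintype (α i)]

theorem marginal_mul {f g h : (∀ i, α i) → ℝ} {S : Set V} (hf : ∀ x, f x = h x * g x)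
    (hh : DependsOn h S) (x : ∀ i, α i) : marginal f S x = h x * marginal g S x := by
  unfold marginal
  rw [Finset.mul_sum]
  refine Finset.sum_congr rfl fun y _ => ?_
  by_cases hy : ∀ i ∈ S, y i = x i
  · rw [if_pos hy, if_pos hy, hf, hh hy]
  · rw [if_neg hy, if_neg hy, mul_zero]

theorem dependsOn_marginal_inter {g : (∀ i, α i) → ℝ} {U : Set V} (hg : DependsOn g U)
    (S : Set V) : DependsOn (marginal g S) (S ∩ U) := by
  classical
  intro x x' hx
  unfold marginal
  rw [← Finset.sum_filter, ← Finset.sum_filter]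
  -- Exchanging the values of `x` and `x'` on `S` matches the two sets of configurations. It
  -- preserves `g`, since only coordinates in `S` outside `U` can change.
  refine Finset.sum_nbij' (fun y => S.piecewise x' y) (fun y => S.piecewise x y) ?_ ?_ ?_ ?_ ?_
  · intro y _
    simp +contextual
  · intro y _
    simp +contextual
  · intro y hy
    simp only [Finset.mem_filter] at hy
    funext i
    by_cases hi : i ∈ S
    · simp [hi, hy.2 i hi]
    · simp [hi]
  · intro y hy
    simp only [Finset.mem_filter] at hy
    funext i
    by_cases hi : i ∈ S
    · simp [hi, hy.2 i hi]
    · simp [hi]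
  · intro y hy
    simp only [Finset.mem_filter] at hy
    refine hg fun i hi => ?_
    by_cases hiS : i ∈ S
    · simp [hiS, hy.2 i hiS, hx i ⟨hiS, hi⟩]
    · simp [hiS]

/-- A law that factorizes over the cliques of `G` is Markov with respect to every moral orientation
of `G`. -/
theorem isMarkov_of_clique_factorization {G : SimpleGraph V} {D : Digraph V}
    (hD : G.IsMoralOrientation D) {ι : Type*} [Fintype ι] {k : ι → (∀ i, α i) → ℝ} {C : ι → Set V}
    (hpos : ∀ i x, 0 < k i x) (hk : ∀ i, DependsOn (k i) (C i)) (hC : ∀ i, G.IsClique (C i)) :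
    IsMarkov D fun x => ∏ i, k i x := by
  classical
  have key : ∀ a, ∃ κ : (∀ i, α i) → ℝ, DependsOn κ (insert a (D.parents a)) ∧
      ∀ x, marginal (fun x => ∏ i, k i x) (insert a (D.nondescendants a)) x =
        κ x * marginal (fun x => ∏ i, k i x) (D.nondescendants a) x := by
    intro a
    set N := D.nondescendants a with hN
    -- A clique not contained in `U` meets the non-descendants outside the parents of `a`, hence
    -- lies in `N`. The product `h` of these factors depends only on `N` and cancels from the
    -- conditional law; the product `g` of the others depends only on `U`.
    set U : Set V := (N \ D.parents a)ᶜ with hU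
    set F := Finset.univ.filter fun i => C i ⊆ U with hF
    set g : (∀ i, α i) → ℝ := fun x => ∏ i ∈ F, k i x with hg
    set h : (∀ i, α i) → ℝ := fun x => ∏ i ∈ Fᶜ, k i x with hh
    have hgpos : ∀ x, 0 < g x := fun x => Finset.prod_pos fun i _ => hpos i x
    have hgU : DependsOn g U := dependsOn_prod fun i hi x y hxy =>
      hk i fun j hj => hxy j ((Finset.mem_filter.1 hi).2 hj)
    have hhN : DependsOn h N := by
      refine dependsOn_prod fun i hi x y hxy => hk i fun j hj => hxy j ?_
      simp only [hF, Finset.mem_compl, Finset.mem_filter, Finset.mem_univ, true_and,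
        Set.not_subset] at hi
      obtain ⟨d, hdC, hd⟩ := hi
      rw [hU, Set.notMem_compl_iff] at hd
      exact hD.clique_subset_nondescendants (hC i) hdC hd.1 hd.2 hj
    have hf : ∀ x, ∏ i, k i x = h x * g x := fun x => by
      rw [mul_comm, hg, hh, Finset.prod_mul_prod_compl]
    refine ⟨fun x => marginal g (insert a N) x / marginal g N x, ?_, fun x => ?_⟩
    · intro x y hxy
      have h1 : insert a N ∩ U ⊆ insert a (D.parents a) := by
        rintro i ⟨rfl | hi, hiU⟩
        · exact Or.inl rfl
        · exact Or.inr (by_contra fun h => hiU ⟨hi, h⟩)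
      beta_reduce
      rw [dependsOn_marginal_inter hgU (insert a N) fun i hi => hxy i (h1 hi),
        dependsOn_marginal_inter hgU N fun i hi => hxy i (h1 ⟨Or.inr hi.1, hi.2⟩)]
    · rw [marginal_mul hf hhN, marginal_mul hf (S := insert a N) fun x y hxy => hhN fun i hi => hxy i (Or.inr hi)]
      have := (marginal_pos hgpos N x).ne'
      beta_reduce
      field_simp
  choose κ hκ hκ' using key
  exact isMarkov_of_marginal_eq hD.isDAG κ hκ hκ'

/-! ### Interventional equivalence of moral orientations -/

theorem IsInterventionalFamily.of_isMoralOrientation {G : SimpleGraph V} {D D' : Digraph V}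
    (hD : G.IsMoralOrientation D) (hD' : G.IsMoralOrientation D') {v : V}
    (hv : D.parents v = D'.parents v) {f : Set V → (∀ i, α i) → ℝ}
    (hf : IsInterventionalFamily D {{v}} f) : IsInterventionalFamily D' {{v}} f := by
  classical
  obtain ⟨hlaw, hpos, hM⟩ := hf.1 ∅ (Or.inl rfl)
  obtain ⟨hlawv, hposv, hMv⟩ := hf.1 {v} (Or.inr rfl)
  have hcond := hf.2 ∅ (Or.inl rfl) {v} (Or.inr rfl)
  rw [Digraph.intervene_empty] at hM
  have hprod := hM.eq_prod hD.isDAG hlaw hpos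
  have hM' : IsMarkov D' (f ∅) := by
    rw [funext hprod]
    exact isMarkov_of_clique_factorization hD'
      (fun i => conditional_pos hpos i _) (fun i => dependsOn_conditional _ i _)
      hD.isClique_parents
  have hprod' := hM'.eq_prod hD'.isDAG hlaw hpos
  have := hlaw.nonempty
  refine (isKernelFamily_conditional hD'.isDAG hpos).isInterventionalFamily hD'.isDAG
    (isRootKernel_conditional hposv v) (funext hprod') (funext fun x => ?_)
  -- Multiplying by the observational conditional of `v` completes the other factors to `f ∅`, for
  -- `D` and `D'` alike; the completing factor is the same because the parents of `v` agree.
  have hne := (conditional_pos hpos v (D.parents v) x).ne'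
  refine mul_left_cancel₀ hne ?_
  have h1 : f {v} x = conditional (f {v}) v ∅ x *
      ∏ i ∈ Finset.univ.erase v, conditional (f ∅) i (D.parents i) x := by
    rw [hMv.eq_prod (hD.isDAG.intervene {v}) hlawv hposv,
      ← Finset.mul_prod_erase _ _ (Finset.mem_univ v),
      D.parents_intervene_of_mem (Set.mem_singleton v)]
    congr 1
    refine Finset.prod_congr rfl fun i hi => ?_
    have hiv := Finset.ne_of_mem_erase hi
    rw [hD.isDAG.parents_intervene_of_notMem (by simpa using hiv)]
    exact (hcond i (by simpa using hiv) x).symm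
  rw [h1, ← Finset.mul_prod_erase _ (fun i => Function.update
      (fun i => conditional (f ∅) i (D'.parents i)) v (conditional (f {v}) v ∅) i x)
      (Finset.mem_univ v),
    Function.update_self, mul_left_comm, mul_left_comm (conditional (f ∅) v (D.parents v) x)]
  congr 1
  rw [Finset.mul_prod_erase _ (fun i => conditional (f ∅) i (D.parents i) x) (Finset.mem_univ v),
    ← hprod, hprod', ← Finset.mul_prod_erase _ _ (Finset.mem_univ v), hv]
  congr 1
  exact Finset.prod_congr rfl fun i hi => by
    rw [Function.update_of_ne (Finset.ne_of_mem_erase hi)]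

/-- The bridge from statistics to graphs: after this, only moral orientations with a prescribed
parent set at `v` are involved. -/
theorem iEssentialGraph_adj_iff {G : SimpleGraph V} {D : Digraph V}
    (hD : G.IsMoralOrientation D) {v a b : V} :
    (iEssentialGraph {{v}} D).Adj a b ↔
      ∃ D', G.IsMoralOrientation D' ∧ D'.parents v = D.parents v ∧ D'.Adj a b := by
  constructor
  · rintro ⟨D', ⟨hD', he⟩, hab⟩
    have hm : G.IsMoralOrientation D' :=
      hD.of_hasSink_iff hD' fun T hT => he.hasSink_iff hD.isDAG hD' hT
    refine ⟨D', hm, ?_, hab⟩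
    ext c
    rw [hD'.mem_parents, hD.isDAG.mem_parents]
    constructor
    · intro h
      exact ((hD.adj_iff _ _).2 (hm.adj h)).resolve_right (he.symm.not_adj hD' hD.isDAG h)
    · intro h
      exact ((hm.adj_iff _ _).2 (hD.adj h)).resolve_right (he.not_adj hD.isDAG hD' h)
  · rintro ⟨D', hm, hv, hab⟩
    exact ⟨D', ⟨hm.isDAG, fun α _ f => ⟨fun h => h.of_isMoralOrientation hD hm hv.symm,
      fun h => h.of_isMoralOrientation hm hD hv⟩⟩, hab⟩

end CausalModel

/-! ### Descendants, separation and reorientation in moral orientations -/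

namespace SimpleGraph.IsMoralOrientation

variable {V : Type*} {G : SimpleGraph V} {D : Digraph V}

theorem mem_parents_or_adj (h : G.IsMoralOrientation D) {v b : V} (hvb : G.Adj v b) :
    b ∈ D.parents v ∨ D.Adj v b :=
  ((h.adj_iff v b).2 hvb).symm.imp_left h.isDAG.mem_parents.2

/-- A node joined to `v` by a path avoiding the parents of `v` is a descendant of `v`. -/
theorem reflTransGen_of_reachable (h : G.IsMoralOrientation D) {v : V} {b c : ↥(D.parents v)ᶜ}
    (hb : Relation.ReflTransGen D.Adj v b) (hbc : (G.induce (D.parents v)ᶜ).Reachable b c) :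
    Relation.ReflTransGen D.Adj v c := by
  obtain ⟨p⟩ := hbc
  induction p with
  | nil => exact hb
  | @cons b d _ hbd _ ih =>
    exact ih ((h.reflTransGen_or_adj hb hbd).resolve_right fun h' =>
      d.2 (h.isDAG.mem_parents.2 h'))

theorem reflTransGen_of_not_isSeparator (h : G.IsMoralOrientation D) {v b : V}
    (hb : b ∉ D.parents v) (hsep : ¬ G.IsSeparator (D.parents v) b v) :
    Relation.ReflTransGen D.Adj v b := by
  have hv := h.isDAG.notMem_parents v
  have hr : (G.induce (D.parents v)ᶜ).Reachable ⟨b, hb⟩ ⟨v, hv⟩ := by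
    by_contra hr
    exact hsep ⟨hb, hv, hr⟩
  exact h.reflTransGen_of_reachable (b := ⟨v, hv⟩) .refl hr.symm

/-- A parent or child of `v` has no parent among the nodes that are neither adjacent to `v` nor
separated from `v` by the parents of `v`. -/
theorem not_adj_of_not_isSeparator (h : G.IsMoralOrientation D) {v a b : V}
    (ha : G.Adj v a) (hb : b ≠ v) (hvb : ¬ G.Adj v b)
    (hsep : ¬ G.IsSeparator (D.parents v) b v) : ¬ D.Adj b a := by
  intro hba
  have hbp : b ∉ D.parents v := fun h' => hvb (h.adj h'.1).symm
  -- If `a` is a child of `v`, then `v` and `b` are two parents of `a` and must be adjacent. If `a`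
  -- is a parent, then `b`, a descendant of `v`, closes a directed cycle through `a`.
  rcases (h.adj_iff v a).2 ha with hva | hav
  · exact hvb (h.moral _ _ _ hva hba hb.symm)
  · exact h.isDAG v (((Relation.TransGen.single hba).tail hav).trans_right
      (h.reflTransGen_of_not_isSeparator hbp hsep))

theorem not_adj_parents_of_adj (h : G.IsMoralOrientation D) {v a b : V} (ha : a ∈ D.parents v)
    (hb : D.Adj v b) : ¬ D.Adj b a :=
  fun hba => h.isDAG v (((Relation.TransGen.single hb).tail hba).tail ha.1)

/-- Reorient the edges inside a set of nodes `W` that no edge enters. -/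
theorem reorient {D₀ : Digraph V} (h : G.IsMoralOrientation D) (h₀ : G.IsMoralOrientation D₀)
    {W : Set V} (hW : ∀ a b, b ∈ W → D.Adj a b → a ∈ W) :
    G.IsMoralOrientation
      ⟨fun a b => (a ∈ W ∧ b ∈ W ∧ D₀.Adj a b) ∨ (b ∉ W ∧ D.Adj a b)⟩ := by
  refine ⟨fun a haa => ?_, fun a b => ?_, fun a b c => ?_⟩
  -- No new edge enters `W`: a path ending in `W` stays in `W` and uses `D₀`, while a path starting
  -- outside stays outside and uses `D`. A cycle is therefore a cycle of one of the two.
  · have key : ∀ b, Relation.TransGen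
        (fun a b => (a ∈ W ∧ b ∈ W ∧ D₀.Adj a b) ∨ (b ∉ W ∧ D.Adj a b)) a b →
        (b ∈ W → a ∈ W ∧ Relation.TransGen D₀.Adj a b) ∧
        (a ∉ W → b ∉ W ∧ Relation.TransGen D.Adj a b) := by
      intro b hab
      induction hab with
      | single hab =>
        rcases hab with ⟨ha, hb, hab⟩ | ⟨hb, hab⟩
        · exact ⟨fun _ => ⟨ha, .single hab⟩, fun h' => absurd ha h'⟩
        · exact ⟨fun h' => absurd h' hb, fun _ => ⟨hb, .single hab⟩⟩
      | tail _ hbc ih =>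
        rcases hbc with ⟨hb, hc, hbc⟩ | ⟨hc, hbc⟩
        · exact ⟨fun _ => ⟨(ih.1 hb).1, (ih.1 hb).2.tail hbc⟩, fun h' => absurd hb (ih.2 h').1⟩
        · exact ⟨fun h' => absurd h' hc, fun h' => ⟨hc, (ih.2 h').2.tail hbc⟩⟩
    by_cases ha : a ∈ W
    · exact h₀.isDAG a ((key a haa).1 ha).2
    · exact h.isDAG a ((key a haa).2 ha).2
  · have h1 := h.adj_iff a b
    have h2 := h₀.adj_iff a b
    have h3 := hW a b
    have h4 := hW b a
    tauto
  · rintro (⟨-, hc, hac⟩ | ⟨hc, hac⟩) (⟨-, hc', hbc⟩ | ⟨hc', hbc⟩)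
    exacts [h₀.moral a b c hac hbc, absurd hc hc', absurd hc' hc, h.moral a b c hac hbc]

end SimpleGraph.IsMoralOrientation

/-- A node separated from `v` by `P` has no neighbors outside `P` that are not separated
from `v` by `P`. -/
theorem SimpleGraph.IsSeparator.of_adj {V : Type*} {G : SimpleGraph V} {P : Set V} {a b v : V}
    (h : G.IsSeparator P a v) (hab : G.Adj a b) (hb : b ∉ P) : G.IsSeparator P b v := by
  obtain ⟨ha, hv, hr⟩ := h
  refine ⟨hb, hv, fun h' => hr (SimpleGraph.Reachable.trans ?_ h')⟩
  exact SimpleGraph.Adj.reachable (by simpa using hab)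

theorem SimpleGraph.IsSeparator.not_adj {V : Type*} {G : SimpleGraph V} {P : Set V} {a v : V}
    (h : G.IsSeparator P a v) : ¬ G.Adj a v := by
  obtain ⟨ha, hv, hr⟩ := h
  exact fun hav => hr (SimpleGraph.Adj.reachable (by simpa using hav))

theorem SimpleGraph.IsSeparator.ne {V : Type*} {G : SimpleGraph V} {P : Set V} {a v : V}
    (h : G.IsSeparator P a v) : a ≠ v := by
  obtain ⟨ha, hv, hr⟩ := h
  rintro rfl
  exact hr .rfl

/-! ### The node partition in terms of moral orientations -/

section Partition

variable {V : Type*} {G : SimpleGraph V} {D : Digraph V} {v : V}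

/-- No edge of a moral orientation enters the set of the parents of `v` and the nodes they
separate from `v`. -/
theorem mem_nodesA_union_parents_of_adj (hD : G.IsMoralOrientation D) {a b : V}
    (hb : b ∈ nodesA G v (D.parents v) ∪ D.parents v) (hab : D.Adj a b) :
    a ∈ nodesA G v (D.parents v) ∪ D.parents v := by
  by_cases haP : a ∈ D.parents v
  · exact Or.inr haP
  rcases hb with hb | hb
  · have hs := hb.2.of_adj (hD.adj hab).symm haP
    exact Or.inl ⟨fun h => hs.not_adj (G.adj_symm h), hs⟩
  · have hav : a ≠ v := by
      rintro rfl
      exact hD.isDAG.asymm hab hb.1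
    -- A neighbor of `v` outside the parents is a child, and a child with an edge into a parent of
    -- `v` gives a cycle.
    have hadj : ¬ G.Adj v a := fun h => hD.not_adj_parents_of_adj hb
      ((hD.mem_parents_or_adj h).resolve_left haP) hab
    refine Or.inl ⟨hadj, ?_⟩
    by_contra hs
    exact hD.not_adj_of_not_isSeparator (hD.adj hb.1).symm hav hadj hs hab

variable [Fintype V]

open CausalModel

/-- Fixing the parents of `v` fixes the direction of every edge at `v`, so none of these edges is
undirected in the union. -/
theorem mem_nodesC_iff (hD : G.IsMoralOrientation D) {b : V} :
    b ∈ nodesC (iEssentialGraph {{v}} D) v ↔ D.Adj v b := by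
  have key : ∀ D', G.IsMoralOrientation D' → D'.parents v = D.parents v →
      D'.Adj v b → D.Adj v b := by
    intro D' hD' hv h
    refine (hD.mem_parents_or_adj (hD'.adj h)).resolve_left fun hb => ?_
    rw [← hv] at hb
    exact hD'.isDAG.asymm h hb.1
  constructor
  · rintro ⟨h, -⟩
    obtain ⟨D', hD', hv, h⟩ := (iEssentialGraph_adj_iff hD).1 h
    exact key D' hD' hv h
  · intro h
    refine ⟨(iEssentialGraph_adj_iff hD).2 ⟨D, hD, rfl, h⟩, fun h' => ?_⟩
    obtain ⟨D', hD', hv, h'⟩ := (iEssentialGraph_adj_iff hD).1 h'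
    have : b ∈ D.parents v := hv ▸ hD'.isDAG.mem_parents.2 h'
    exact hD.isDAG.asymm h this.1

theorem isDirectedEdge_of_forall (hD : G.IsMoralOrientation D) {a b : V}
    (h : ∀ D', G.IsMoralOrientation D' → D'.parents v = D.parents v → ¬ D'.Adj b a)
    (hab : (iEssentialGraph {{v}} D).HasEdge a b) :
    (iEssentialGraph {{v}} D).IsDirectedEdge a b := by
  have hba : ¬ (iEssentialGraph {{v}} D).Adj b a := fun h' => by
    obtain ⟨D', hD', hv, h'⟩ := (iEssentialGraph_adj_iff hD).1 h'
    exact h D' hD' hv h'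
  exact ⟨hab.resolve_right hba, hba⟩

theorem nodesD_spec (hD : G.IsMoralOrientation D) {b : V}
    (hb : b ∈ nodesD G (iEssentialGraph {{v}} D) v (D.parents v)) :
    b ≠ v ∧ ¬ G.Adj v b ∧ b ∉ D.parents v ∧ ¬ G.IsSeparator (D.parents v) b v := by
  simp only [nodesD, Set.mem_compl_iff, Set.mem_union, mem_nodesC_iff hD, Set.mem_singleton_iff,
    not_or] at hb
  obtain ⟨⟨⟨hA, hC⟩, hP⟩, hv⟩ := hb
  have hadj : ¬ G.Adj v b := fun h => (hD.mem_parents_or_adj h).elim hP hC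
  exact ⟨hv, hadj, hP, fun h => hA ⟨hadj, h⟩⟩

end Partition

open CausalModel in
theorem theorem1 {V : Type*} [Fintype V] (G : SimpleGraph V) (hG : G.IsUCCG) (v : V) (P : Set V)
    (R : Digraph V) (hR : CausalModel.IsInterventionResult G v P R) :
    (∀ a ∈ nodesA G v P, ∀ b ∈ nodesC R v ∪ nodesD G R v P ∪ {v}, ¬ G.Adj a b) ∧
    (∀ a ∈ P, ∀ b ∈ nodesC R v, R.HasEdge a b → R.IsDirectedEdge a b) ∧
    (∀ a ∈ nodesC R v ∪ P, ∀ b ∈ nodesD G R v P, R.HasEdge a b → R.IsDirectedEdge a b) ∧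
    (∀ a ∈ nodesA G v P ∪ P, ∀ b ∈ nodesA G v P ∪ P, R.HasEdge a b →
      R.Adj a b ∧ R.Adj b a) := by
  obtain ⟨D, hmec, rfl, rfl⟩ := hR
  have hD := isMoralOrientation_of_mem_mec hmec
  refine ⟨?_, ?_, ?_, ?_⟩
  · rintro a ha b ((hb | hb) | rfl) hab
    · have hvb := (mem_nodesC_iff hD).1 hb
      exact (ha.2.of_adj hab fun h => hD.isDAG.asymm hvb h.1).not_adj (hD.adj hvb).symm
    · obtain ⟨-, -, hP, hs⟩ := nodesD_spec hD hb
      exact hs (ha.2.of_adj hab hP)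
    · exact ha.2.not_adj hab
  · intro a ha b hb
    refine isDirectedEdge_of_forall hD fun D' hD' hv => ?_
    have hvb := (mem_nodesC_iff hD).1 hb
    refine hD'.not_adj_parents_of_adj (hv ▸ ha) ?_
    refine (hD'.mem_parents_or_adj (hD.adj hvb)).resolve_left fun h => ?_
    rw [hv] at h
    exact hD.isDAG.asymm hvb h.1
  · intro a ha b hb
    refine isDirectedEdge_of_forall hD fun D' hD' hv => ?_
    obtain ⟨hbv, hadj, -, hs⟩ := nodesD_spec hD hb
    refine hD'.not_adj_of_not_isSeparator ?_ hbv hadj (hv ▸ hs)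
    rcases ha with ha | ha
    · exact hD.adj ((mem_nodesC_iff hD).1 ha)
    · exact (hD.adj ha.1).symm
  · have hvW : v ∉ nodesA G v (D.parents v) ∪ D.parents v := by
      rintro (h | h)
      exacts [h.2.ne rfl, hD.isDAG.notMem_parents v h]
    have key : ∀ a ∈ nodesA G v (D.parents v) ∪ D.parents v,
        ∀ b ∈ nodesA G v (D.parents v) ∪ D.parents v, G.Adj a b →
        (iEssentialGraph {{v}} D).Adj a b := by
      intro a ha b hb hab
      -- Some member of the class has `a → b`. Its orientation is grafted into `D` inside the union
      -- of `A_R` and `P`; as `v` lies outside, its parents are unchanged.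
      obtain ⟨D₀, hD₀, he, hab₀⟩ := exists_markovEquiv_of_mem_mec hmec hab
      have hm := hD.reorient
        (hD.of_hasSink_iff hD₀ fun T hT => he.hasSink_iff hmec.1 hD₀ hT)
        fun a b => mem_nodesA_union_parents_of_adj hD (v := v)
      refine (iEssentialGraph_adj_iff hD).2 ⟨_, hm, ?_, Or.inl ⟨ha, hb, hab₀⟩⟩
      ext c
      rw [hm.isDAG.mem_parents, hD.isDAG.mem_parents]
      exact ⟨fun h => h.elim (fun h => absurd h.2.1 hvW) fun h => h.2, fun h => Or.inr ⟨hvW, h⟩⟩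
    intro a ha b hb hab
    have hGab : G.Adj a b := by
      rcases hab with h | h
      · obtain ⟨D', hD', -, h⟩ := (iEssentialGraph_adj_iff hD).1 h
        exact hD'.adj h
      · obtain ⟨D', hD', -, h⟩ := (iEssentialGraph_adj_iff hD).1 h
        exact (hD'.adj h).symm
    exact ⟨key a ha b hb hGab, key b hb a ha hGab.symm⟩
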